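/- **Theorem (Locally Gorenstein Rings Having the Cayley-Bacharach Property).** Let $K$ be a field, $P=K[x_1,\dots,x_n]$, let $I\subset P$ be a $0$-dimensional ideal (i.e. $P/I$ has Krull dimension $0$), and let $R=P/I$. *Notation.* For $i\in\mathbb Z$ let $F_iP=\{f\in P\mid \deg f\le i\}\cup\{0\}$ and let $F_iR$ be the image of $F_iP$ in $R$. Let $\operatorname{ri}(R)=\min\{i\in\mathbb Z\mid \dim_K F_jR=\dim_K R \text{ for all } j\ge i\}$, and for $f\in R\setminus\{0\}$ let $\operatorname{ord}(f)=\min\{i\mid f\in F_iR\setminus F_{i-1}R\}$. The canonical module is $\omega_R=\operatorname{Hom}_K(R,K)$ with $(f\varphi)(g)=\varphi(fg)$; put $G_i\omega_R=\{\varphi\in\omega_R\mid\varphi(F_{-i-1}R)=0\}$, and for $\varphi\ne0$ let $\operatorname{ord}(\varphi)=\min\{i\in\mathbb Z\mid\varphi\in G_i\omega_R\}$. For a field extension $L\supseteq K$ let $R_L=R\otimes_KL$, an affine $L$-algebra with the generators $\bar x_j\otimes1$, i.e. $R_L\cong L[x_1,\dots,x_n]/I\,L[x_1,\dots,x_n]$;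 the above notions are used for $R_L$ over $L$ in the same way. Let $I=\mathfrak Q_1\cap\dots\cap\mathfrak Q_s$ be the primary decomposition of $I$ and $\mathfrak M_i=\operatorname{Rad}(\mathfrak Q_i)$. A *minimal $\mathfrak Q_i$-divisor* of $I$ is an ideal $J=\mathfrak Q_i'\cap\bigcap_{j\ne i}\mathfrak Q_j$, where $\mathfrak Q_i'\subseteq P$ is an ideal with $\mathfrak Q_i\subsetneq\mathfrak Q_i'$ (and $\mathfrak Q_i'=P$ is allowed), such that $\dim_K(J/I)=\dim_K(P/\mathfrak M_i)$. The *separator degree* of the maximal ideal $\mathfrak m_i=\mathfrak M_i/I$ is the minimum, over all minimal $\mathfrak Q_i$-divisors $J$ of $I$, of $\max\{\operatorname{ord}(f)\mid f\in (J/I)\setminus\{0\}\}$. The ring $R$ has the *Cayley-Bacharach property* if the separator degree of $\mathfrak m_i$ equals $\operatorname{ri}(R)$ for every $i=1,\dots,s$. The ring $R$ is *locally Gorenstein* if, for each primary component $\mathfrak q$ of the zero ideal of $R$, the local ring $A=R/\mathfrak q$ with maximal ideal $\mathfrak m_A$ satisfies $\dim_{A/\mathfrak m_A}\operatorname{Ann}_A(\mathfrak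 m_A)=1$. *Claim.* The following conditions are equivalent. (a) There exist a field extension $K\subseteq L$ and an element $\varphi\in\omega_{R_L}$ such that $\operatorname{ord}(\varphi)=-\operatorname{ri}(R_L)$ and $\operatorname{Ann}_{R_L}(\varphi)=\{0\}$. (b) The ring $R$ is locally Gorenstein and has the Cayley-Bacharach property. If $K$ is infinite and these conditions hold, then $L=K$ satisfies condition (a). -/

import Mathlib

open scoped TensorProduct

universe u v

noncomputable section

namespace CayleyBacharach

section Filtration

variable (k : Type*) [Field k] {n : ℕ}

/-- The degree filtration of the polynomial ring `P = k[x₁, …, xₙ]`: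
`F_i P = {f ∈ P | deg f ≤ i} ∪ {0}` for `i ∈ ℤ`. -/
def polyFiltration (n : ℕ) (i : ℤ) : Submodule k (MvPolynomial (Fin n) k) where
  carrier := {f | f = 0 ∨ (f.totalDegree : ℤ) ≤ i}
  zero_mem' := Or.inl rfl
  add_mem' := by
    rintro f g (rfl | hf) (rfl | hg)
    · simp
    · right; simpa using hg
    · right; simpa using hf
    · right
      have h := MvPolynomial.totalDegree_add f g
      rcases le_total f.totalDegree g.totalDegree with h' | h'
      · rw [max_eq_right h'] at h; omega
      · rw [max_eq_left h'] at h; omega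
  smul_mem' := by
    rintro c f (rfl | hf)
    · simp
    · right
      have h := MvPolynomial.totalDegree_smul_le c f
      omega

variable {A : Type*} [CommRing A] [Algebra k A] (x : Fin n → A)

/-- The degree filtration of a `k`-algebra `A` generated by `x₁, …, xₙ`, i.e. of `A` presented
as a quotient of `P` by `X_j ↦ x_j`: `F_i A` is the image of `F_i P`. -/
def degreeFiltration (i : ℤ) : Submodule k A :=
  (polyFiltration k n i).map (MvPolynomial.aeval x : MvPolynomial (Fin n) k →ₐ[k] A).toLinearMap

/-- The affine Hilbert function `i ↦ dim_k (F_i A)`. -/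
def hilbertFunction (i : ℤ) : ℕ := Module.finrank k (degreeFiltration k x i)

/-- The regularity index: the least `i` with `HF(j) = dim_k A` for all `j ≥ i`. -/
def regularityIndex : ℤ :=
  sInf {i : ℤ | ∀ j : ℤ, i ≤ j → hilbertFunction k x j = Module.finrank k A}

/-- The order of a (non-zero) element of `A` with respect to the degree filtration. -/
def order (f : A) : ℤ :=
  sInf {i : ℤ | f ∈ degreeFiltration k x i ∧ f ∉ degreeFiltration k x (i - 1)}

/-- For a non-zero ideal `J` of `A`, the largest order of a non-zero element of `J`. -/
def idealRegularityIndex (J : Ideal A) : ℤ :=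
  sSup {r : ℤ | ∃ f ∈ J, f ≠ 0 ∧ order k x f = r}

end Filtration

section Canonical

/-- The canonical module `ω_A = Hom_k(A, k)`. -/
def CanonicalModule (k A : Type*) [Field k] [CommRing A] [Algebra k A] : Type _ :=
  A →ₗ[k] k

variable (k : Type*) [Field k] {n : ℕ} {A : Type*} [CommRing A] [Algebra k A]

instance : AddCommGroup (CanonicalModule k A) := inferInstanceAs (AddCommGroup (A →ₗ[k] k))

instance : Module k (CanonicalModule k A) := inferInstanceAs (Module k (A →ₗ[k] k))

instance : FunLike (CanonicalModule k A) A k := inferInstanceAs (FunLike (A →ₗ[k] k) A k)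

/-- The `A`-module structure of `ω_A`: `(f • φ)(g) = φ(f * g)`. -/
instance : Module A (CanonicalModule k A) where
  smul f φ := LinearMap.comp (φ : A →ₗ[k] k) (LinearMap.mulLeft k f)
  one_smul φ := LinearMap.ext fun g => congrArg (φ : A →ₗ[k] k) (one_mul g)
  mul_smul a b φ := LinearMap.ext fun g =>
    congrArg (φ : A →ₗ[k] k) (show a * b * g = b * (a * g) by ring)
  smul_zero _ := rfl
  smul_add _ _ _ := rfl
  add_smul a b φ := LinearMap.ext fun g =>
    (congrArg (φ : A →ₗ[k] k) (add_mul a b g)).trans (LinearMap.map_add (φ : A →ₗ[k] k) _ _)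
  zero_smul φ := LinearMap.ext fun g =>
    (congrArg (φ : A →ₗ[k] k) (zero_mul g)).trans (LinearMap.map_zero (φ : A →ₗ[k] k))

theorem CanonicalModule.smul_apply (f g : A) (φ : CanonicalModule k A) :
    (f • φ) g = φ (f * g) := rfl

/-- The degree filtration of `ω_A`: `G_i ω_A = {φ | φ(F_{-i-1} A) = 0}`. -/
def canonicalFiltration (x : Fin n → A) (i : ℤ) : Set (CanonicalModule k A) :=
  {φ | ∀ f ∈ degreeFiltration k x (-i - 1), φ f = 0}

/-- The order of a (non-zero) element of `ω_A` with respect to the degree filtration. -/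
def canonicalOrder (x : Fin n → A) (φ : CanonicalModule k A) : ℤ :=
  sInf {i : ℤ | φ ∈ canonicalFiltration k x i}

/-- There is `φ ∈ ω_A` of order `-ri(A)` with `Ann_A(φ) = 0`. -/
def HasFaithfulFormOfLeastOrder (x : Fin n → A) : Prop :=
  ∃ φ : CanonicalModule k A,
    canonicalOrder k x φ = -regularityIndex k x ∧
      Ideal.torsionOf A (CanonicalModule k A) φ = ⊥

end Canonical

section Gorenstein

/-- A zero-dimensional local ring `(A, 𝔪)` is Gorenstein if its socle `Ann_A(𝔪)` has
dimension one over `A/𝔪`. -/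
def IsGorensteinLocal (A : Type*) [CommRing A] : Prop :=
  ∃ _ : IsLocalRing A,
    Module.finrank (A ⧸ IsLocalRing.maximalIdeal A)
      (Submodule.torsionBySet A A (IsLocalRing.maximalIdeal A)) = 1

/-- A zero-dimensional Noetherian ring is locally Gorenstein if its quotients by the primary
components of the zero ideal are Gorenstein local rings. (In dimension zero the minimal primary
decomposition `t` exists and is unique.) -/
def IsLocallyGorenstein (R : Type*) [CommRing R] : Prop :=
  ∀ t : Finset (Ideal R), Submodule.IsMinimalPrimaryDecomposition (⊥ : Ideal R) t →
    ∀ q ∈ t, IsGorensteinLocal (R ⧸ q)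

end Gorenstein

section CBP

variable {K : Type*} [Field K] {n : ℕ} (I : Ideal (MvPolynomial (Fin n) K))

/-- The residue classes of the indeterminates in `P/I`. -/
def coords (j : Fin n) : MvPolynomial (Fin n) K ⧸ I := Ideal.Quotient.mk I (MvPolynomial.X j)

open Classical in
/-- Let `t` be the set of primary components of `I` and `Q ∈ t`. A `Q`-divisor of `I` is an
ideal obtained from the intersection of all components by replacing `Q` with a strictly larger
ideal `Q'`. Here `Q' = P` is possible; this is needed when `Q` is maximal. -/
def IsDivisor (t : Finset (Ideal (MvPolynomial (Fin n) K)))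
    (Q J : Ideal (MvPolynomial (Fin n) K)) : Prop :=
  ∃ Q' : Ideal (MvPolynomial (Fin n) K), Q < Q' ∧ J = Q' ⊓ (t.erase Q).inf id

/-- A minimal `Q`-divisor of `I`: a `Q`-divisor `J` with `dim_K (J/I) = dim_K (P/Rad(Q))`. -/
def IsMinimalDivisor (t : Finset (Ideal (MvPolynomial (Fin n) K)))
    (Q J : Ideal (MvPolynomial (Fin n) K)) : Prop :=
  IsDivisor t Q J ∧
    Module.finrank K (J.map (Ideal.Quotient.mk I)) =
      Module.finrank K (MvPolynomial (Fin n) K ⧸ Q.radical)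

/-- The separator degree of the maximal ideal of `P/I` which belongs to the component `Q`. -/
def separatorDegree (t : Finset (Ideal (MvPolynomial (Fin n) K)))
    (Q : Ideal (MvPolynomial (Fin n) K)) : ℤ :=
  sInf {r : ℤ | ∃ J : Ideal (MvPolynomial (Fin n) K), IsMinimalDivisor I t Q J ∧
    idealRegularityIndex K (coords I) (J.map (Ideal.Quotient.mk I)) = r}

/-- The Cayley-Bacharach property of `P/I`: all separator degrees are equal to the
regularity index. (For zero-dimensional `I`, the minimal primary decomposition `t` exists and is
unique.) -/
def HasCayleyBacharachProperty : Prop :=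
  ∀ t : Finset (Ideal (MvPolynomial (Fin n) K)), Submodule.IsMinimalPrimaryDecomposition I t →
    ∀ Q ∈ t, separatorDegree I t Q = regularityIndex K (coords I)

/-- The generators `1 ⊗ x_j` of the affine `L`-algebra
`R_L = L ⊗_K (P/I) ≅ L[x₁, …, xₙ]/I L[x₁, …, xₙ]`. -/
def coordsBaseChange (L : Type*) [Field L] [Algebra K L] (j : Fin n) :
    L ⊗[K] (MvPolynomial (Fin n) K ⧸ I) :=
  1 ⊗ₜ[K] coords I j

end CBP

end CayleyBacharach

end

/-! Put r = ri(R). Both conditions become statements about F_{r-1}R. A non-zero functional has order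
-r exactly when it vanishes on F_{r-1}R, and it is faithful exactly when its kernel contains no
non-zero ideal; (a) asks for a functional on R_L with both properties. On the other side, the
Cayley-Bacharach property says that F_{r-1}R contains no non-zero ideal
(`hasCayleyBacharachProperty_iff`), and local Gorensteinness says that every socle Ann_R(m) is
cyclic (`isLocallyGorenstein_iff_hasCyclicSocles`).

From (a) to (b): an ideal inside F_{r-1}R would extend to an ideal inside ker φ, and pairing the
socle with R/m through φ bounds its dimension by that of R/m (`HasCyclicSocles.of_isNondegenerate`).

From (b) to (a): cyclic socles yield a functional σ with no non-zero ideal in its kernel, so every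
functional has the form f_j σ. Let the f_j σ span the functionals that vanish on F_{r-1}R. No
non-zero element kills all f_j, so by McCoy's theorem ∑ f_j X^j is a non-zero-divisor of R[X] and
the Gram determinant of ∑ X^j f_j σ is a non-zero polynomial (`det_gramPolynomial_ne_zero`). Any
non-root in an infinite extension L gives the required form; L = K(X) always works, and L = K does
if K is infinite. -/

noncomputable section

namespace CayleyBacharach

/-! ### Degree filtrations, orders and the regularity index -/

section Filtration

variable {k : Type*} [Field k] {n : ℕ} {A : Type*} [CommRing A] [Algebra k A] (x : Fin n → A)

theorem degreeFiltration_mono : Monotone (degreeFiltration k x) := by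
  intro i j hij
  refine Submodule.map_mono ?_
  rintro f (hf | hf)
  · exact Or.inl hf
  · exact Or.inr (hf.trans hij)

theorem degreeFiltration_of_neg {i : ℤ} (hi : i < 0) : degreeFiltration k x i = ⊥ := by
  rw [eq_bot_iff]
  rintro _ ⟨f, hf | hf, rfl⟩
  · simp [hf]
  · omega

theorem exists_mem_degreeFiltration
    (hx : Function.Surjective (MvPolynomial.aeval x : MvPolynomial (Fin n) k →ₐ[k] A)) (a : A) :
    ∃ m : ℕ, a ∈ degreeFiltration k x m := by
  obtain ⟨p, rfl⟩ := hx a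
  exact ⟨p.totalDegree, p, Or.inr le_rfl, rfl⟩

theorem exists_degreeFiltration_eq_top [Module.Finite k A]
    (hx : Function.Surjective (MvPolynomial.aeval x : MvPolynomial (Fin n) k →ₐ[k] A)) :
    ∃ m : ℕ, degreeFiltration k x m = ⊤ := by
  obtain ⟨N, hN⟩ := monotone_stabilizes_iff_noetherian.mpr (inferInstance : IsNoetherian k A)
    ⟨fun m : ℕ => degreeFiltration k x m,
      fun a b h => degreeFiltration_mono x (Int.ofNat_le.mpr h)⟩
  refine ⟨N, eq_top_iff.mpr fun a _ => ?_⟩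
  obtain ⟨m, hm⟩ := exists_mem_degreeFiltration x hx a
  have h := hN (max N m) (le_max_left _ _)
  change degreeFiltration k x N = degreeFiltration k x _ at h
  rw [h]
  exact degreeFiltration_mono x (Int.ofNat_le.mpr (le_max_right _ _)) hm

theorem degreeFiltration_eq_top_iff [Module.Finite k A] [Nontrivial A]
    (hx : Function.Surjective (MvPolynomial.aeval x : MvPolynomial (Fin n) k →ₐ[k] A)) {i : ℤ} :
    degreeFiltration k x i = ⊤ ↔ regularityIndex k x ≤ i := by
  have hset : {i : ℤ | ∀ j : ℤ, i ≤ j → hilbertFunction k x j = Module.finrank k A} =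
      {i | degreeFiltration k x i = ⊤} := by
    ext i
    constructor
    · intro h
      exact Submodule.eq_top_of_finrank_eq (h i le_rfl)
    · intro h j hij
      have h' : degreeFiltration k x j = ⊤ :=
        eq_top_iff.mpr (le_of_eq_of_le (Eq.symm h) (degreeFiltration_mono x hij))
      rw [hilbertFunction, h', finrank_top]
  -- Without a lower bound `sInf` on ℤ takes the default value 0; here `Nontrivial A` excludes
  -- negative indices.
  have hbdd : BddBelow {i | degreeFiltration k x i = ⊤} := by
    refine ⟨0, fun i hi => ?_⟩
    by_contra hneg
    have h := degreeFiltration_of_neg (k := k) x (not_le.mp hneg)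
    rw [show degreeFiltration k x i = ⊤ from hi] at h
    exact top_ne_bot h
  rw [regularityIndex, hset]
  constructor
  · intro h
    exact csInf_le hbdd h
  · intro h
    obtain ⟨m, hm⟩ := exists_degreeFiltration_eq_top x hx
    have h' := Int.csInf_mem (s := {i | degreeFiltration k x i = ⊤}) ⟨m, hm⟩ hbdd
    exact eq_top_iff.mpr (le_of_eq_of_le (Eq.symm h') (degreeFiltration_mono x h))

theorem mem_degreeFiltration_iff_order_le
    (hx : Function.Surjective (MvPolynomial.aeval x : MvPolynomial (Fin n) k →ₐ[k] A)) {a : A}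
    (ha : a ≠ 0) {i : ℤ} : a ∈ degreeFiltration k x i ↔ order k x a ≤ i := by
  obtain ⟨m, hm⟩ := exists_mem_degreeFiltration x hx a
  obtain ⟨r, hr, hmin⟩ := Int.exists_least_of_bdd (P := fun i => a ∈ degreeFiltration k x i)
    ⟨0, fun i hi => by
      by_contra hneg
      rw [degreeFiltration_of_neg x (not_le.mp hneg)] at hi
      exact ha hi⟩ ⟨m, hm⟩
  have hset : {i : ℤ | a ∈ degreeFiltration k x i ∧ a ∉ degreeFiltration k x (i - 1)} = {r} := by
    ext i
    constructor
    · rintro ⟨h1, h2⟩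
      by_contra hne
      have hlt : r < i := lt_of_le_of_ne (hmin i h1) (Ne.symm hne)
      exact h2 (degreeFiltration_mono x (by omega) hr)
    · rintro rfl
      exact ⟨hr, fun h => by have := hmin _ h; omega⟩
  rw [order, hset, csInf_singleton]
  exact ⟨fun h => hmin i h, fun h => degreeFiltration_mono x h hr⟩

theorem order_nonneg
    (hx : Function.Surjective (MvPolynomial.aeval x : MvPolynomial (Fin n) k →ₐ[k] A)) {a : A}
    (ha : a ≠ 0) : 0 ≤ order k x a := by
  by_contra hneg
  have h := (mem_degreeFiltration_iff_order_le x hx ha).mpr le_rfl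
  rw [degreeFiltration_of_neg x (not_le.mp hneg)] at h
  exact ha h

theorem order_le_regularityIndex [Module.Finite k A] [Nontrivial A]
    (hx : Function.Surjective (MvPolynomial.aeval x : MvPolynomial (Fin n) k →ₐ[k] A)) {a : A}
    (ha : a ≠ 0) : order k x a ≤ regularityIndex k x := by
  rw [← mem_degreeFiltration_iff_order_le x hx ha, (degreeFiltration_eq_top_iff x hx).mpr le_rfl]
  trivial

theorem idealRegularityIndex_nonneg [Module.Finite k A] [Nontrivial A]
    (hx : Function.Surjective (MvPolynomial.aeval x : MvPolynomial (Fin n) k →ₐ[k] A))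
    {J : Ideal A} (hJ : J ≠ ⊥) : 0 ≤ idealRegularityIndex k x J := by
  obtain ⟨a, haJ, ha⟩ := Submodule.exists_mem_ne_zero_of_ne_bot hJ
  refine (order_nonneg x hx ha).trans (le_csSup ⟨regularityIndex k x, ?_⟩ ⟨a, haJ, ha, rfl⟩)
  rintro _ ⟨b, -, hb, rfl⟩
  exact order_le_regularityIndex x hx hb

theorem idealRegularityIndex_le_regularityIndex [Module.Finite k A] [Nontrivial A]
    (hx : Function.Surjective (MvPolynomial.aeval x : MvPolynomial (Fin n) k →ₐ[k] A))
    {J : Ideal A} (hJ : J ≠ ⊥) : idealRegularityIndex k x J ≤ regularityIndex k x := by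
  obtain ⟨a, haJ, ha⟩ := Submodule.exists_mem_ne_zero_of_ne_bot hJ
  refine csSup_le ⟨_, a, haJ, ha, rfl⟩ ?_
  rintro _ ⟨b, -, hb, rfl⟩
  exact order_le_regularityIndex x hx hb

/-- Orders never exceed the regularity index, so the maximum is reached as soon as one element lies
outside the last proper filtration step. -/
theorem idealRegularityIndex_eq_iff [Module.Finite k A] [Nontrivial A]
    (hx : Function.Surjective (MvPolynomial.aeval x : MvPolynomial (Fin n) k →ₐ[k] A))
    {J : Ideal A} (hJ : J ≠ ⊥) :
    idealRegularityIndex k x J = regularityIndex k x ↔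
      ∃ a ∈ J, a ∉ degreeFiltration k x (regularityIndex k x - 1) := by
  obtain ⟨a, haJ, ha⟩ := Submodule.exists_mem_ne_zero_of_ne_bot hJ
  have hbdd : BddAbove {r : ℤ | ∃ f ∈ J, f ≠ 0 ∧ order k x f = r} := by
    refine ⟨regularityIndex k x, ?_⟩
    rintro _ ⟨b, -, hb, rfl⟩
    exact order_le_regularityIndex x hx hb
  constructor
  · intro h
    obtain ⟨b, hbJ, hb, hr⟩ :=
      Int.csSup_mem (s := {r : ℤ | ∃ f ∈ J, f ≠ 0 ∧ order k x f = r}) ⟨_, a, haJ, ha, rfl⟩ hbdd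
    refine ⟨b, hbJ, ?_⟩
    rw [mem_degreeFiltration_iff_order_le x hx hb, hr]
    rw [idealRegularityIndex] at h
    omega
  · rintro ⟨b, hbJ, hb⟩
    have hb0 : b ≠ 0 := by
      rintro rfl
      exact hb (zero_mem _)
    rw [mem_degreeFiltration_iff_order_le x hx hb0] at hb
    have h1 := order_le_regularityIndex x hx hb0
    exact le_antisymm (idealRegularityIndex_le_regularityIndex x hx hJ)
      (le_csSup hbdd ⟨b, hbJ, hb0, by omega⟩)

/-- A non-zero φ cannot vanish on the whole of A, so -ri(A) is the least order possible. The zero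
functional has to be excluded, since it lies in every filtration step. -/
theorem canonicalOrder_eq_neg_regularityIndex_iff [Module.Finite k A] [Nontrivial A]
    (hx : Function.Surjective (MvPolynomial.aeval x : MvPolynomial (Fin n) k →ₐ[k] A))
    {φ : CanonicalModule k A} (hφ : ∃ a, φ a ≠ 0) :
    canonicalOrder k x φ = -regularityIndex k x ↔
      ∀ a ∈ degreeFiltration k x (regularityIndex k x - 1), φ a = 0 := by
  have hlow : ∀ i : ℤ, φ ∈ canonicalFiltration k x i → -regularityIndex k x ≤ i := by
    intro i hi
    by_contra hlt
    obtain ⟨a, ha⟩ := hφ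
    refine ha (hi a ?_)
    rw [(degreeFiltration_eq_top_iff x hx).mpr (by omega)]
    trivial
  have hbdd : BddBelow {i : ℤ | φ ∈ canonicalFiltration k x i} := ⟨_, hlow⟩
  constructor
  · intro h a ha
    have hne : {i : ℤ | φ ∈ canonicalFiltration k x i}.Nonempty := by
      refine ⟨0, fun b hb => ?_⟩
      rw [degreeFiltration_of_neg x (by norm_num)] at hb
      rw [(Submodule.mem_bot k).mp hb]
      exact LinearMap.map_zero (φ : A →ₗ[k] k)
    have h' := Int.csInf_mem hne hbdd
    rw [← canonicalOrder, h] at h'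
    exact h' a (by simpa using ha)
  · intro h
    have hmem : φ ∈ canonicalFiltration k x (-regularityIndex k x) := by
      intro a ha
      exact h a (by simpa using ha)
    exact le_antisymm (csInf_le hbdd hmem) (le_csInf ⟨_, hmem⟩ hlow)

theorem hasFaithfulFormOfLeastOrder_iff [Module.Finite k A] [Nontrivial A]
    (hx : Function.Surjective (MvPolynomial.aeval x : MvPolynomial (Fin n) k →ₐ[k] A)) :
    HasFaithfulFormOfLeastOrder k x ↔ ∃ φ : A →ₗ[k] k,
      (∀ a ∈ degreeFiltration k x (regularityIndex k x - 1), φ a = 0) ∧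
        ∀ a, (∀ g, φ (a * g) = 0) → a = 0 := by
  have key : ∀ φ : CanonicalModule k A,
      Ideal.torsionOf A (CanonicalModule k A) φ = ⊥ ↔ ∀ a, (∀ g, φ (a * g) = 0) → a = 0 := by
    intro φ
    rw [eq_bot_iff]
    refine forall_congr' fun a => imp_congr ?_ Iff.rfl
    rw [Ideal.mem_torsionOf_iff]
    exact LinearMap.ext_iff (f := (a • φ : CanonicalModule k A)) (g := (0 : A →ₗ[k] k))
  have hne : ∀ φ : CanonicalModule k A, (∀ a, (∀ g, φ (a * g) = 0) → a = 0) → ∃ a, φ a ≠ 0 := by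
    intro φ h
    by_contra! h0
    exact one_ne_zero (h 1 fun g => h0 _)
  constructor
  · rintro ⟨φ, h1, h2⟩
    rw [key] at h2
    exact ⟨φ, (canonicalOrder_eq_neg_regularityIndex_iff x hx (hne φ h2)).mp h1, h2⟩
  · rintro ⟨φ, h1, h2⟩
    exact ⟨φ, (canonicalOrder_eq_neg_regularityIndex_iff x hx (φ := φ) (hne φ h2)).mpr h1,
      (key φ).mpr h2⟩

end Filtration

/-! ### Extension of the base field -/

section BaseChange

variable {k : Type*} [Field k] {n : ℕ} {A : Type*} [CommRing A] [Algebra k A] (x : Fin n → A)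
  (L : Type*) [Field L] [Algebra k L]

theorem aeval_tmul_map (p : MvPolynomial (Fin n) k) :
    MvPolynomial.aeval (fun j => (1 : L) ⊗ₜ[k] x j) (MvPolynomial.map (algebraMap k L) p) =
      (1 : L) ⊗ₜ[k] MvPolynomial.aeval x p := by
  rw [MvPolynomial.aeval_map_algebraMap]
  exact (MvPolynomial.comp_aeval_apply (R := k) (f := x)
    (Algebra.TensorProduct.includeRight : A →ₐ[k] L ⊗[k] A) p).symm

/-- Each filtration step is spanned by monomials in the generators, and monomials are defined over
k. -/
theorem degreeFiltration_baseChange (i : ℤ) :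
    degreeFiltration L (fun j => (1 : L) ⊗ₜ[k] x j) i = (degreeFiltration k x i).baseChange L := by
  apply le_antisymm
  · rintro _ ⟨p, hp, rfl⟩
    obtain rfl | hp := hp
    · simp
    change MvPolynomial.aeval _ p ∈ _
    rw [p.as_sum, map_sum]
    refine Submodule.sum_mem _ fun d hd => ?_
    have h : MvPolynomial.monomial d (p.coeff d) = p.coeff d •
        MvPolynomial.map (algebraMap k L) (MvPolynomial.monomial d (1 : k)) := by
      rw [MvPolynomial.map_monomial, map_one, MvPolynomial.smul_monomial, smul_eq_mul, mul_one]
    rw [h, map_smul, aeval_tmul_map]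
    refine Submodule.smul_mem _ _ (Submodule.tmul_mem_baseChange_of_mem _ ⟨_, Or.inr ?_, rfl⟩)
    rw [MvPolynomial.totalDegree_monomial d one_ne_zero]
    exact (Int.ofNat_le.mpr (MvPolynomial.le_totalDegree hd)).trans hp
  · rw [Submodule.baseChange_eq_span, Submodule.span_le]
    rintro _ ⟨_, ⟨p, hp, rfl⟩, rfl⟩
    refine ⟨MvPolynomial.map (algebraMap k L) p, ?_, aeval_tmul_map x L p⟩
    obtain rfl | hp := hp
    · simp
    · exact Or.inr ((Int.ofNat_le.mpr
        (Finset.sup_mono (MvPolynomial.support_map_subset (algebraMap k L) p))).trans hp)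

theorem finrank_submodule_baseChange (p : Submodule k A) :
    Module.finrank L (p.baseChange L) = Module.finrank k p := by
  rw [Submodule.baseChange, LinearMap.finrank_range_of_inj, Module.finrank_baseChange]
  exact Module.Flat.lTensor_preserves_injective_linearMap _ p.injective_subtype

theorem regularityIndex_baseChange :
    regularityIndex L (fun j => (1 : L) ⊗ₜ[k] x j) = regularityIndex k x := by
  have h : ∀ j, hilbertFunction L (fun j => (1 : L) ⊗ₜ[k] x j) j = hilbertFunction k x j :=
    fun j => by
      rw [hilbertFunction, degreeFiltration_baseChange, finrank_submodule_baseChange,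
        hilbertFunction]
  simp only [regularityIndex, h, Module.finrank_baseChange]

theorem aeval_tmul_surjective
    (hx : Function.Surjective (MvPolynomial.aeval x : MvPolynomial (Fin n) k →ₐ[k] A)) :
    Function.Surjective (MvPolynomial.aeval (fun j => (1 : L) ⊗ₜ[k] x j) :
      MvPolynomial (Fin n) L →ₐ[L] L ⊗[k] A) := by
  intro a
  induction a with
  | zero => exact ⟨0, map_zero _⟩
  | tmul c a =>
    obtain ⟨p, rfl⟩ := hx a
    refine ⟨c • MvPolynomial.map (algebraMap k L) p, ?_⟩
    rw [map_smul, aeval_tmul_map, TensorProduct.smul_tmul', smul_eq_mul, mul_one]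
  | add a b ha hb =>
    obtain ⟨p, rfl⟩ := ha
    obtain ⟨q, rfl⟩ := hb
    exact ⟨p + q, map_add _ _ _⟩

end BaseChange

/-! ### Nondegenerate functionals and generic linear combinations -/

section Functionals

open Polynomial

variable {k : Type*} [Field k] {A : Type*} [CommRing A] [Algebra k A]

/-- A functional on `A` is nondegenerate if its kernel contains no non-zero ideal. -/
def IsNondegenerate (φ : A →ₗ[k] k) : Prop :=
  ∀ a, (∀ g, φ (a * g) = 0) → a = 0

/-- Every functional is a multiple of a nondegenerate one. -/
theorem IsNondegenerate.exists_eq_mul [Module.Finite k A] {σ : A →ₗ[k] k}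
    (hσ : IsNondegenerate σ) (φ : A →ₗ[k] k) : ∃ f, ∀ a, φ a = σ (f * a) := by
  have hinj : Function.Injective ((LinearMap.mul k A).compr₂ σ) := by
    rw [injective_iff_map_eq_zero]
    exact fun a ha => hσ a fun g => LinearMap.congr_fun ha g
  have hsurj := (LinearMap.injective_iff_surjective_of_finrank_eq_finrank
    (Subspace.dual_finrank_eq (K := k) (V := A)).symm).mp hinj
  obtain ⟨f, hf⟩ := hsurj φ
  exact ⟨f, fun a => (LinearMap.congr_fun hf a).symm⟩

/-- The Gram matrix of the family `∑ Xʲ φⱼ` of functionals. -/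
def gramPolynomial {ι : Type*} (b : ι → A) {r : ℕ} (φ : Fin r → A →ₗ[k] k) :
    Matrix ι ι k[X] :=
  Matrix.of fun i i' => ∑ j : Fin r, C (φ j (b i * b i')) * X ^ (j : ℕ)

/-- Write φ_j = f_j σ and F = ∑ f_j X^j. A kernel vector of the Gram matrix amounts to a non-zero G
in A[X] with F G = 0. By McCoy's theorem F is then killed by a non-zero constant of A, which kills
every f_j. -/
theorem det_gramPolynomial_ne_zero {ι : Type*} [Fintype ι] [DecidableEq ι] (b : Module.Basis ι k A)
    {σ : A →ₗ[k] k} (hσ : IsNondegenerate σ) {r : ℕ} (φ : Fin r → A →ₗ[k] k)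
    (hφ : ∀ a, (∀ j g, φ j (a * g) = 0) → a = 0) : (gramPolynomial b φ).det ≠ 0 := by
  have : Module.Finite k A := Module.Finite.of_basis b
  intro hdet
  obtain ⟨v, hv, hv0⟩ := Matrix.exists_mulVec_eq_zero_iff.mpr hdet
  choose f hf using fun j => hσ.exists_eq_mul (φ j)
  set F : A[X] := ∑ j : Fin r, C (f j) * X ^ (j : ℕ) with hF
  set G : A[X] := ∑ i, C (b i) * (v i).map (algebraMap k A) with hG
  have hG0 : G ≠ 0 := by
    intro h0
    refine hv (funext fun i => Polynomial.ext fun m => ?_)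
    have h := congrArg (fun p => p.coeff m) h0
    simp only [hG, finsetSum_coeff, coeff_C_mul, coeff_map, coeff_zero] at h
    have h' := Fintype.linearIndependent_iff.mp b.linearIndependent (fun i => (v i).coeff m) (by
      rw [← h]
      exact Finset.sum_congr rfl fun i _ => by rw [Algebra.smul_def, mul_comm])
    simpa using h' i
  -- The Gram matrix represents the form (p, q) ↦ σ(F p q), with σ applied coefficientwise.
  have hcoeff : ∀ i m, (Matrix.mulVec (gramPolynomial b φ) v i).coeff m =
      σ (b i * (F * G).coeff m) := by
    intro i m
    simp only [Matrix.mulVec, dotProduct, gramPolynomial, Matrix.of_apply, hF, hG, Finset.sum_mul,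
      Finset.mul_sum, finsetSum_coeff, map_sum]
    refine Finset.sum_congr rfl fun i' _ => Finset.sum_congr rfl fun j _ => ?_
    rw [mul_assoc, mul_assoc, coeff_C_mul, coeff_C_mul, coeff_X_pow_mul', coeff_X_pow_mul']
    split_ifs
    · rw [coeff_C_mul, coeff_map, hf, mul_comm _ (algebraMap k A _), ← Algebra.smul_def,
        mul_smul_comm, mul_smul_comm, map_smul, smul_eq_mul, mul_comm,
        mul_left_comm (f j)]
    · simp
  have hFG : F * G = 0 := by
    refine Polynomial.ext fun m => ?_
    rw [coeff_zero]
    refine hσ _ fun g => ?_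
    have hz : (LinearMap.mul k A).compr₂ σ ((F * G).coeff m) = 0 := by
      refine b.ext fun i => ?_
      have h := hcoeff i m
      rw [hv0] at h
      simpa [mul_comm] using h.symm
    exact LinearMap.congr_fun hz g
  have hF' : F ∉ nonZeroDivisors A[X] := fun h =>
    hG0 ((mul_left_mem_nonZeroDivisors_eq_zero_iff h).mp hFG)
  -- McCoy's theorem: the annihilator of F can be chosen among the constants.
  obtain ⟨a, ha, haF⟩ := Polynomial.notMem_nonZeroDivisors_iff.mp hF'
  refine ha (hφ a fun j g => ?_)
  have h := congrArg (fun p => p.coeff (j : ℕ)) haF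
  simp only [hF, coeff_smul, finsetSum_coeff, coeff_C_mul, coeff_X_pow, coeff_zero, smul_eq_mul,
    mul_ite, mul_one, mul_zero, Fin.val_inj, Finset.sum_ite_eq, Finset.mem_univ, if_true] at h
  rw [hf, ← mul_assoc, mul_comm (f j), h, zero_mul, map_zero]

/-- The base change of a functional. -/
def functionalBaseChange (L : Type*) [Field L] [Algebra k L] (φ : A →ₗ[k] k) :
    L ⊗[k] A →ₗ[L] L :=
  (TensorProduct.AlgebraTensorModule.rid k L L).toLinearMap ∘ₗ φ.baseChange L

theorem functionalBaseChange_tmul (L : Type*) [Field L] [Algebra k L] (φ : A →ₗ[k] k) (c : L)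
    (a : A) : functionalBaseChange L φ (c ⊗ₜ a) = φ a • c := by
  simp [functionalBaseChange]

/-- If a family of functionals is not annihilated by a non-zero element of an algebra which
has some nondegenerate functional, then over every infinite extension field some linear
combination of the family is nondegenerate. -/
theorem exists_isNondegenerate_sum [Module.Finite k A] {σ : A →ₗ[k] k} (hσ : IsNondegenerate σ)
    {r : ℕ} (φ : Fin r → A →ₗ[k] k) (hφ : ∀ a, (∀ j g, φ j (a * g) = 0) → a = 0)
    (L : Type*) [Field L] [Algebra k L] [Infinite L] :
    ∃ c : Fin r → L, IsNondegenerate (∑ j, c j • functionalBaseChange L (φ j)) := by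
  classical
  let b := Module.finBasis k A
  have hdet := det_gramPolynomial_ne_zero b hσ φ hφ
  obtain ⟨c, hc⟩ : ∃ c : L, aeval c (gramPolynomial b φ).det ≠ 0 := by
    by_contra! h
    refine hdet ((Polynomial.map_eq_zero (algebraMap k L)).mp (Polynomial.funext fun c => ?_))
    rw [eval_map_algebraMap, h, eval_zero]
  refine ⟨fun j => c ^ (j : ℕ), fun g hg => ?_⟩
  set ψ := ∑ j : Fin r, c ^ (j : ℕ) • functionalBaseChange L (φ j) with hψ
  have hgram : ∀ i i', aeval c (gramPolynomial b φ i i') = ψ (1 ⊗ₜ (b i * b i')) := by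
    intro i i'
    simp only [gramPolynomial, Matrix.of_apply, hψ, map_sum, map_mul, aeval_C, map_pow, aeval_X,
      LinearMap.sum_apply, LinearMap.smul_apply, functionalBaseChange_tmul]
    exact Finset.sum_congr rfl fun j _ => by
      rw [smul_eq_mul, Algebra.smul_def (φ j _), mul_one, mul_comm]
  let bL := Algebra.TensorProduct.basis L b
  have hbL : ∀ i, bL i = 1 ⊗ₜ b i := fun i => Algebra.TensorProduct.basis_apply b i
  rw [AlgHom.map_det] at hc
  -- The coordinates of an element g with ψ(g · ) = 0 form a kernel vector of the specialized Gram
  -- matrix.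
  have hrepr : (bL.repr g : _ → L) = 0 := by
    by_contra hne
    refine hc (Matrix.exists_mulVec_eq_zero_iff.mp ⟨_, hne, funext fun i => ?_⟩)
    have h := hg (bL i)
    conv at h => lhs; arg 2; rw [← bL.sum_repr g, Finset.sum_mul]
    rw [map_sum] at h
    rw [Pi.zero_apply, ← h]
    simp only [Matrix.mulVec, dotProduct]
    refine Finset.sum_congr rfl fun i' _ => ?_
    rw [AlgHom.mapMatrix_apply, Matrix.map_apply, hgram, smul_mul_assoc, map_smul, hbL, hbL,
      Algebra.TensorProduct.tmul_mul_tmul, one_mul, smul_eq_mul, mul_comm, mul_comm (b i)]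
  have : bL.repr g = 0 := DFunLike.coe_injective hrepr
  simpa using this

end Functionals

/-! ### Cyclic socles and nondegenerate functionals -/

section Socle

/-- All the socles `Ann_R(𝔪)` at maximal ideals `𝔪` of `R` are cyclic and non-zero. -/
def HasCyclicSocles (R : Type*) [CommRing R] : Prop :=
  ∀ m : Ideal R, m.IsMaximal → ∃ v : R, v ≠ 0 ∧ (∀ r ∈ m, r * v = 0) ∧
    ∀ w, (∀ r ∈ m, r * w = 0) → ∃ c, c * v = w

variable {R : Type*} [CommRing R]

theorem mul_eq_zero_iff_mem_of_isMaximal {m : Ideal R} (hm : m.IsMaximal) {v : R} (hv : v ≠ 0)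
    (h : ∀ r ∈ m, r * v = 0) {r : R} : r * v = 0 ↔ r ∈ m := by
  refine ⟨fun hr => ?_, h r⟩
  by_contra hrm
  obtain ⟨s, y, hy, hs⟩ := hm.exists_inv hrm
  refine hv ?_
  rw [← one_mul v, ← hs, add_mul, mul_assoc, hr, h y hy, mul_zero, add_zero]

theorem exists_eq_span_singleton_of_isAtom {S : Ideal R} (hS : IsAtom S) :
    ∃ a : R, a ≠ 0 ∧ S = Ideal.span {a} ∧ (Ideal.torsionOf R R a).IsMaximal := by
  obtain ⟨a, haS, ha⟩ := Submodule.exists_mem_ne_zero_of_ne_bot hS.1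
  have hspan : Ideal.span {a} = S :=
    (hS.le_iff.mp ((Ideal.span_singleton_le_iff_mem S).mpr haS)).resolve_left
      fun h => ha (Ideal.span_singleton_eq_bot.mp h)
  refine ⟨a, ha, hspan.symm, ⟨?_⟩⟩
  rw [← isSimpleModule_iff_isCoatom]
  have : IsSimpleModule R S := isSimpleModule_iff_isAtom.mpr hS
  subst hspan
  exact IsSimpleModule.congr (Ideal.quotTorsionOfEquivSpanSingleton R R a)

theorem exists_ne_zero_forall_mul_eq_zero [IsArtinianRing R] {m : Ideal R} (hm : m.IsMaximal) :
    ∃ v : R, v ≠ 0 ∧ ∀ r ∈ m, r * v = 0 := by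
  have hmin : m ∈ (Module.annihilator R R).minimalPrimes := by
    rw [Module.annihilator_eq_bot.mpr inferInstance]
    exact Ideal.mem_minimalPrimes_of_krullDimLE_zero m
  obtain ⟨-, v, rfl⟩ := isAssociatedPrime_iff.mp
    (Module.associatedPrimes.minimalPrimes_annihilator_subset_associatedPrimes R R hmin)
  refine ⟨v, ?_, fun r hr => by simpa [Submodule.mem_colon_singleton] using hr⟩
  rintro rfl
  exact hm.ne_top (by simp)

variable {K : Type*} [Field K] [Algebra K R] [Module.Finite K R]

/-- Generators of the socles at different maximal ideals are linearly independent, so some σ is 1 on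
all of them. Every non-zero ideal contains a simple one, hence one of these generators, and so is
not contained in ker σ. -/
theorem HasCyclicSocles.exists_isNondegenerate (h : HasCyclicSocles R) :
    ∃ σ : R →ₗ[K] K, IsNondegenerate σ := by
  classical
  have : IsArtinianRing R := isArtinian_of_tower K inferInstance
  choose v hv0 hv hgen using fun m : MaximalSpectrum R => h m.1 m.2
  have hli : LinearIndependent K v := by
    rw [linearIndependent_iff']
    intro s g hs m hm
    -- Multiplication by e isolates the m-term of the relation.
    obtain ⟨e, he, hem⟩ : ∃ e ∈ (s.erase m).inf MaximalSpectrum.asIdeal, e ∉ m.asIdeal := by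
      by_contra! hle
      obtain ⟨m', hm', hle'⟩ := (Ideal.IsPrime.inf_le' m.2.isPrime).mp hle
      exact (Finset.mem_erase.mp hm').1 (MaximalSpectrum.ext (m'.2.eq_of_le m.2.ne_top hle'))
    have hsum : e * ∑ i ∈ s, g i • v i = g m • (e * v m) := by
      rw [Finset.mul_sum, Finset.sum_eq_single_of_mem m hm, mul_smul_comm]
      intro m' hm' hne
      rw [mul_smul_comm, hv m' e, smul_zero]
      exact (Finset.le_inf_iff.mp le_rfl m' (Finset.mem_erase.mpr ⟨hne, hm'⟩) :
        (s.erase m).inf MaximalSpectrum.asIdeal ≤ m'.asIdeal) he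
    rw [hs, mul_zero] at hsum
    refine (smul_eq_zero.mp hsum.symm).resolve_right fun h0 => hem ?_
    exact (mul_eq_zero_iff_mem_of_isMaximal m.2 (hv0 m) (hv m)).mp h0
  obtain ⟨σ, hσ⟩ := LinearMap.exists_extend ((Module.Basis.span hli).constr K fun _ => (1 : K))
  have hσv : ∀ m, σ (v m) = 1 := by
    intro m
    have h1 := LinearMap.congr_fun hσ (Module.Basis.span hli m)
    rwa [Module.Basis.constr_basis, LinearMap.comp_apply, Submodule.subtype_apply,
      Module.Basis.span_apply] at h1
  refine ⟨σ, fun a ha => ?_⟩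
  by_contra hne
  obtain ⟨S, hS, hSa⟩ := (eq_bot_or_exists_atom_le (Ideal.span {a})).resolve_left
    fun h => hne (Ideal.span_singleton_eq_bot.mp h)
  obtain ⟨s, hs0, rfl, hmax⟩ := exists_eq_span_singleton_of_isAtom hS
  obtain ⟨r, rfl⟩ := Ideal.mem_span_singleton'.mp
    ((Ideal.span_singleton_le_iff_mem _).mp hSa)
  set m : MaximalSpectrum R := ⟨_, hmax⟩
  obtain ⟨c, hc⟩ := hgen m (r * a) fun t ht => ht
  have hcm : c ∉ m.asIdeal := fun hcm => hs0 (by rw [← hc, hv m c hcm])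
  obtain ⟨d, y, hy, hd⟩ := m.2.exists_inv hcm
  refine one_ne_zero ((hσv m).symm.trans ?_)
  rw [← one_mul (v m), ← hd, add_mul, hv m y hy, add_zero, mul_assoc, hc, ← mul_assoc, mul_comm]
  exact ha _

/-- Let T = Ann_R(m) and let U be a K-complement of m. As T m = 0, nondegeneracy makes the pairing L
⊗ T → Hom_K(U, L) injective, so dim T ≤ dim U = dim R/m. For non-zero v in T, Rv ≅ R/m lies in T and
therefore fills it. The socle is thus controlled without extending m to L ⊗ R. -/
theorem HasCyclicSocles.of_isNondegenerate {L : Type*} [Field L] [Algebra K L]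
    {φ : L ⊗[K] R →ₗ[L] L} (hφ : IsNondegenerate φ) : HasCyclicSocles R := by
  have : IsArtinianRing R := isArtinian_of_tower K inferInstance
  intro m hm
  obtain ⟨v, hv0, hv⟩ := exists_ne_zero_forall_mul_eq_zero hm
  refine ⟨v, hv0, hv, ?_⟩
  let T : Submodule K R := (Submodule.torsionBySet R R m).restrictScalars K
  have hT : ∀ w, w ∈ T ↔ ∀ r ∈ m, r * w = 0 := fun w => by
    simp [T, Submodule.mem_torsionBySet_iff]
  obtain ⟨U, hU⟩ := Submodule.exists_isCompl (m.restrictScalars K)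
  let τ : R →ₗ[K] L := φ.restrictScalars K ∘ₗ TensorProduct.mk K L R 1
  let ψ : T →ₗ[K] U →ₗ[K] L := ((LinearMap.mul K R).compr₂ τ).domRestrict₁₂ T U
  let Ψ : L ⊗[K] T →ₗ[L] U →ₗ[K] L := LinearMap.liftBaseChange L ψ
  have hΨ : ∀ (x : L ⊗[K] T) (u : U),
      Ψ x u = φ (T.subtype.baseChange L x * (1 ⊗ₜ[K] (u : R))) := by
    intro x u
    induction x with
    | zero => simp
    | tmul c t =>
      rw [LinearMap.liftBaseChange_tmul, LinearMap.baseChange_tmul,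
        Algebra.TensorProduct.tmul_mul_tmul, mul_one, LinearMap.smul_apply]
      conv_rhs => rw [← mul_one c, ← smul_eq_mul, ← TensorProduct.smul_tmul', map_smul]
      rfl
    | add x y hx hy => rw [map_add, LinearMap.add_apply, hx, hy, map_add, add_mul, map_add]
  have hTm : ∀ (x : L ⊗[K] T) (r : R), r ∈ m → T.subtype.baseChange L x * (1 ⊗ₜ[K] r) = 0 := by
    intro x r hr
    induction x with
    | zero => simp
    | tmul c t =>
      rw [LinearMap.baseChange_tmul, Algebra.TensorProduct.tmul_mul_tmul, Submodule.subtype_apply,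
        mul_comm (t : R), (hT t).mp t.2 r hr, TensorProduct.tmul_zero]
    | add x y hx hy => rw [map_add, add_mul, hx, hy, add_zero]
  have hinj : Function.Injective Ψ := by
    rw [injective_iff_map_eq_zero]
    intro x hx
    have hx0 : T.subtype.baseChange L x = 0 := by
      refine hφ _ fun g => ?_
      induction g with
      | zero => simp
      | tmul c r =>
        obtain ⟨y, hy, u, hu, rfl⟩ := Submodule.mem_sup.mp
          (hU.sup_eq_top ▸ Submodule.mem_top : r ∈ m.restrictScalars K ⊔ U)
        have hc : c ⊗ₜ[K] (y + u) = c • ((1 : L) ⊗ₜ[K] y + (1 : L) ⊗ₜ[K] u) := by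
          rw [← TensorProduct.tmul_add, TensorProduct.smul_tmul', smul_eq_mul, mul_one]
        rw [hc, mul_smul_comm, map_smul, mul_add, hTm x y hy, zero_add, ← hΨ x ⟨u, hu⟩, hx,
          LinearMap.zero_apply, smul_zero]
      | add g g' hg hg' => rw [mul_add, map_add, hg, hg', add_zero]
    exact Module.Flat.lTensor_preserves_injective_linearMap (M := L) _ T.injective_subtype
      (hx0.trans (map_zero _).symm)
  have hle : Module.finrank K T ≤ Module.finrank K U := by
    have h := LinearMap.finrank_le_finrank_of_injective hinj
    rwa [Module.finrank_baseChange, Module.finrank_linearMap, Module.finrank_self, mul_one] at h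
  have hker : LinearMap.ker (LinearMap.mulRight K v) = m.restrictScalars K := by
    ext r
    exact mul_eq_zero_iff_mem_of_isMaximal hm hv0 hv
  have h1 := LinearMap.finrank_range_add_finrank_ker (LinearMap.mulRight K v)
  have h2 := Submodule.finrank_add_eq_of_isCompl hU
  rw [hker] at h1
  have hrange : LinearMap.range (LinearMap.mulRight K v) ≤ T := by
    rintro _ ⟨c, rfl⟩
    rw [hT]
    intro r hr
    rw [LinearMap.mulRight_apply, mul_left_comm, hv r hr, mul_zero]
  have heq := Submodule.eq_of_le_of_finrank_le hrange (by omega)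
  intro w hw
  obtain ⟨c, hc⟩ := (heq ▸ (hT w).mpr hw : w ∈ LinearMap.range (LinearMap.mulRight K v))
  exact ⟨c, hc⟩

end Socle

/-! ### Faithful forms of least order -/

section Faithful

variable {k : Type*} [Field k] {n : ℕ} {A : Type*} [CommRing A] [Algebra k A] [Module.Finite k A]
  [Nontrivial A] {x : Fin n → A} (L : Type*) [Field L] [Algebra k L]

theorem HasFaithfulFormOfLeastOrder.of_hasCyclicSocles [Infinite L]
    (hx : Function.Surjective (MvPolynomial.aeval x : MvPolynomial (Fin n) k →ₐ[k] A))
    (h : HasCyclicSocles A)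
    (h' : ∀ a, (∀ g, a * g ∈ degreeFiltration k x (regularityIndex k x - 1)) → a = 0) :
    HasFaithfulFormOfLeastOrder L (fun j => (1 : L) ⊗ₜ[k] x j) := by
  obtain ⟨σ, hσ⟩ := h.exists_isNondegenerate (K := k)
  rw [hasFaithfulFormOfLeastOrder_iff _ (aeval_tmul_surjective x L hx),
    regularityIndex_baseChange, degreeFiltration_baseChange]
  set F := degreeFiltration k x (regularityIndex k x - 1)
  -- The coordinate functionals of A/F have F as their common kernel, so an element annihilating
  -- them all generates an ideal inside F.
  let b := Module.finBasis k (A ⧸ F)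
  obtain ⟨c, hc⟩ := exists_isNondegenerate_sum hσ (fun j => b.coord j ∘ₗ F.mkQ) (by
    refine fun a ha => h' a fun g => ?_
    rw [← Submodule.Quotient.mk_eq_zero]
    exact b.forall_coord_eq_zero_iff.mp fun j => ha j g) L
  refine ⟨_, fun a ha => ?_, hc⟩
  rw [Submodule.baseChange_eq_span] at ha
  induction ha using Submodule.span_induction with
  | mem y hy =>
    obtain ⟨f, hf, rfl⟩ := hy
    rw [LinearMap.sum_apply]
    refine Finset.sum_eq_zero fun j _ => ?_
    have h0 : (b.coord j ∘ₗ F.mkQ) f = 0 := by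
      rw [LinearMap.comp_apply, Submodule.mkQ_apply, (Submodule.Quotient.mk_eq_zero F).mpr hf,
        map_zero]
    rw [LinearMap.smul_apply, TensorProduct.mk_apply, functionalBaseChange_tmul, h0, zero_smul,
      smul_zero]
  | zero => exact map_zero _
  | add y z _ _ hy hz => rw [map_add, hy, hz, add_zero]
  | smul c y _ hy => rw [map_smul, hy, smul_zero]

theorem HasFaithfulFormOfLeastOrder.eq_zero_of_forall_mul_mem
    (hx : Function.Surjective (MvPolynomial.aeval x : MvPolynomial (Fin n) k →ₐ[k] A))
    (h : HasFaithfulFormOfLeastOrder L (fun j => (1 : L) ⊗ₜ[k] x j)) {a : A}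
    (ha : ∀ g, a * g ∈ degreeFiltration k x (regularityIndex k x - 1)) : a = 0 := by
  rw [hasFaithfulFormOfLeastOrder_iff _ (aeval_tmul_surjective x L hx),
    regularityIndex_baseChange, degreeFiltration_baseChange] at h
  obtain ⟨φ, hφ, hnd⟩ := h
  have h0 : (1 : L) ⊗ₜ[k] a = 0 := by
    refine hnd _ fun g => ?_
    induction g with
    | zero => simp
    | tmul c g =>
      rw [Algebra.TensorProduct.tmul_mul_tmul]
      exact hφ _ (Submodule.tmul_mem_baseChange_of_mem _ (ha g))
    | add g g' hg hg' => rw [mul_add, map_add, hg, hg', add_zero]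
  exact Algebra.TensorProduct.includeRight_injective (R := k) (B := A)
    (algebraMap k L).injective (h0.trans (TensorProduct.tmul_zero A (1 : L)).symm)

theorem HasFaithfulFormOfLeastOrder.hasCyclicSocles
    (hx : Function.Surjective (MvPolynomial.aeval x : MvPolynomial (Fin n) k →ₐ[k] A))
    (h : HasFaithfulFormOfLeastOrder L (fun j => (1 : L) ⊗ₜ[k] x j)) : HasCyclicSocles A := by
  rw [hasFaithfulFormOfLeastOrder_iff _ (aeval_tmul_surjective x L hx)] at h
  obtain ⟨φ, -, hnd⟩ := h
  exact HasCyclicSocles.of_isNondegenerate hnd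

end Faithful

/-! ### Primary components and elements killed by a maximal ideal -/

section PrimaryDecomposition

variable {R : Type*} [CommRing R] {I : Ideal R} {t : Finset (Ideal R)}

theorem eq_radical_of_forall_mul_mem {Q : Ideal R} (hQ : Q.IsPrimary) {m : Ideal R}
    (hm : m.IsMaximal) {a : R} (ha : ∀ r ∈ m, r * a ∈ Q) (haQ : a ∉ Q) : m = Q.radical := by
  refine hm.eq_of_le (Ideal.isPrime_radical hQ).ne_top fun r hr => ?_
  have h := ha r hr
  rw [mul_comm] at h
  exact ((Ideal.isPrimary_iff.mp hQ).2 h).resolve_left haQ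

theorem le_of_mem_isMinimalPrimaryDecomposition (ht : Submodule.IsMinimalPrimaryDecomposition I t)
    {Q : Ideal R} (hQ : Q ∈ t) : I ≤ Q :=
  ht.inf_eq ▸ Finset.inf_le (f := id) hQ

theorem radical_ne_of_mem_erase [DecidableEq (Ideal R)] (ht : Submodule.IsMinimalPrimaryDecomposition I t)
    {Q Q' : Ideal R} (hQ : Q ∈ t) (hQ' : Q' ∈ t.erase Q) : Q'.radical ≠ Q.radical := by
  have h := ht.distinct (Finset.mem_of_mem_erase hQ') hQ (Finset.ne_of_mem_erase hQ')
  simpa only [Function.onFun, Submodule.colon_univ] using h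

/-- A component that misses a must have radical Rad(Q), and distinct components have distinct
radicals. -/
theorem mem_inf_erase_of_forall_mul_mem [DecidableEq (Ideal R)]
    (ht : Submodule.IsMinimalPrimaryDecomposition I t) {Q : Ideal R} (hQ : Q ∈ t)
    (hm : Q.radical.IsMaximal) {a : R} (ha : ∀ r ∈ Q.radical, r * a ∈ I) :
    a ∈ (t.erase Q).inf id := by
  rw [Submodule.mem_finsetInf]
  intro Q' hQ'
  by_contra haQ'
  have hQt := Finset.mem_of_mem_erase hQ'
  exact radical_ne_of_mem_erase ht hQ hQ' (eq_radical_of_forall_mul_mem (ht.primary hQt) hm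
    (fun r hr => le_of_mem_isMinimalPrimaryDecomposition ht hQt (ha r hr)) haQ').symm

theorem inf_inf_erase [DecidableEq (Ideal R)] (ht : Submodule.IsMinimalPrimaryDecomposition I t)
    {Q : Ideal R} (hQ : Q ∈ t) : Q ⊓ (t.erase Q).inf id = I := by
  rw [← ht.inf_eq, ← Finset.insert_erase hQ, Finset.inf_insert, Finset.erase_insert_eq_erase,
    Finset.erase_idem, id]

theorem exists_mem_not_mem (ht : Submodule.IsMinimalPrimaryDecomposition I t) {a : R} (ha : a ∉ I) :
    ∃ Q ∈ t, a ∉ Q := by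
  by_contra! h
  rw [← ht.inf_eq, Submodule.mem_finsetInf] at ha
  exact ha h

theorem exists_isMinimalPrimaryDecomposition [IsNoetherianRing R] (I : Ideal R) :
    ∃ t : Finset (Ideal R), Submodule.IsMinimalPrimaryDecomposition I t :=
  Submodule.IsLasker.exists_isMinimalPrimaryDecomposition (Submodule.isLasker R R) I

theorem sup_inf_erase_eq_top [DecidableEq (Ideal R)] [IsArtinianRing R]
    (ht : Submodule.IsMinimalPrimaryDecomposition I t) {Q : Ideal R} (hQ : Q ∈ t) :
    Q ⊔ (t.erase Q).inf id = ⊤ := by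
  by_contra hne
  obtain ⟨m, hm, hle⟩ := Ideal.exists_le_maximal _ hne
  have key : ∀ Q' ∈ t, Q' ≤ m → Q'.radical = m := fun Q' hQ' h =>
    (Ideal.IsPrime.isMaximal' (Ideal.isPrime_radical (ht.primary hQ'))).eq_of_le hm.ne_top
      (hm.isPrime.radical_le_iff.mpr h)
  obtain ⟨Q', hQ', hle'⟩ := (Ideal.IsPrime.inf_le' hm.isPrime).mp (le_sup_right.trans hle)
  exact radical_ne_of_mem_erase ht hQ hQ' ((key Q' (Finset.mem_of_mem_erase hQ') hle').trans
    (key Q hQ (le_sup_left.trans hle)).symm)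

end PrimaryDecomposition

/-! ### Local Gorensteinness and cyclic socles -/

section Gorenstein

variable {R : Type*} [CommRing R]

theorem isGorensteinLocal_iff {A : Type*} [CommRing A] : IsGorensteinLocal A ↔
    IsLocalRing A ∧ ∃ v : A, v ≠ 0 ∧ (∀ r, ¬ IsUnit r → r * v = 0) ∧
      ∀ w, (∀ r, ¬ IsUnit r → r * w = 0) → ∃ c, c * v = w := by
  rw [IsGorensteinLocal, ← exists_prop]
  refine exists_congr fun hloc => ?_
  let _ : Field (A ⧸ IsLocalRing.maximalIdeal A) := Ideal.Quotient.field _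
  have hmem : ∀ w : A, w ∈ Submodule.torsionBySet A A (IsLocalRing.maximalIdeal A) ↔
      ∀ r, ¬ IsUnit r → r * w = 0 := fun w => by
    simp [Submodule.mem_torsionBySet_iff]
  refine finrank_eq_one_iff'.trans ?_
  constructor
  · rintro ⟨⟨v, hv⟩, hv0, h⟩
    refine ⟨v, fun h0 => hv0 (Subtype.ext h0), (hmem v).mp hv, fun w hw => ?_⟩
    obtain ⟨c, hc⟩ := h ⟨w, (hmem w).mpr hw⟩
    obtain ⟨c, rfl⟩ := Ideal.Quotient.mk_surjective c
    exact ⟨c, congrArg Subtype.val hc⟩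
  · rintro ⟨v, hv0, hv, h⟩
    refine ⟨⟨v, (hmem v).mpr hv⟩, fun h0 => hv0 (congrArg Subtype.val h0), ?_⟩
    rintro ⟨w, hw⟩
    obtain ⟨c, hc⟩ := h w ((hmem w).mp hw)
    exact ⟨Ideal.Quotient.mk _ c, Subtype.ext hc⟩

theorem isUnit_mk_iff_of_isMaximal_radical {q : Ideal R} (hq : q.radical.IsMaximal) {r : R} :
    IsUnit (Ideal.Quotient.mk q r) ↔ r ∉ q.radical := by
  have hnil : ∀ y ∈ q.radical, IsNilpotent (Ideal.Quotient.mk q y) := by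
    rintro y ⟨N, hN⟩
    exact ⟨N, by rw [← map_pow, Ideal.Quotient.eq_zero_iff_mem.mpr hN]⟩
  have hne : q ≠ ⊤ := fun h => hq.ne_top (by rw [h, Ideal.radical_top])
  have : Nontrivial (R ⧸ q) := Ideal.Quotient.nontrivial_iff.mpr hne
  constructor
  · intro hu hr
    exact hu.not_isNilpotent (hnil r hr)
  · intro hr
    obtain ⟨s, y, hy, hs⟩ := hq.exists_inv hr
    have h : Ideal.Quotient.mk q s * Ideal.Quotient.mk q r = 1 - Ideal.Quotient.mk q y := by
      rw [← map_mul, ← map_one (Ideal.Quotient.mk q), ← hs, map_add, add_sub_cancel_right]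
    exact isUnit_of_mul_isUnit_right (h ▸ (hnil y hy).isUnit_one_sub)

theorem isGorensteinLocal_quotient_iff {q : Ideal R} (hq : q.radical.IsMaximal) :
    IsGorensteinLocal (R ⧸ q) ↔ ∃ v, v ∉ q ∧ (∀ r ∈ q.radical, r * v ∈ q) ∧
      ∀ w, (∀ r ∈ q.radical, r * w ∈ q) → ∃ c, c * v - w ∈ q := by
  have hne : q ≠ ⊤ := fun h => hq.ne_top (by rw [h, Ideal.radical_top])
  have : Nontrivial (R ⧸ q) := Ideal.Quotient.nontrivial_iff.mpr hne
  have hloc : IsLocalRing (R ⧸ q) := by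
    refine IsLocalRing.of_nonunits_add fun a b ha hb => ?_
    obtain ⟨a, rfl⟩ := Ideal.Quotient.mk_surjective a
    obtain ⟨b, rfl⟩ := Ideal.Quotient.mk_surjective b
    rw [mem_nonunits_iff, isUnit_mk_iff_of_isMaximal_radical hq, not_not] at ha hb
    rw [← map_add, mem_nonunits_iff, isUnit_mk_iff_of_isMaximal_radical hq, not_not]
    exact add_mem ha hb
  have hsocle : ∀ w, (∀ r, ¬ IsUnit r → r * Ideal.Quotient.mk q w = 0) ↔
      ∀ r ∈ q.radical, r * w ∈ q := by
    intro w
    rw [Ideal.Quotient.mk_surjective.forall]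
    refine forall_congr' fun r => ?_
    rw [isUnit_mk_iff_of_isMaximal_radical hq, not_not, ← map_mul, Ideal.Quotient.eq_zero_iff_mem]
  rw [isGorensteinLocal_iff, and_iff_right hloc, Ideal.Quotient.mk_surjective.exists]
  refine exists_congr fun v => and_congr (not_congr Ideal.Quotient.eq_zero_iff_mem)
    (and_congr (hsocle v) ?_)
  rw [Ideal.Quotient.mk_surjective.forall]
  refine forall_congr' fun w => imp_congr (hsocle w) ?_
  rw [Ideal.Quotient.mk_surjective.exists]
  refine exists_congr fun c => ?_
  rw [← map_mul, Ideal.Quotient.eq]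

/-- Let C be the intersection of the components other than q. Then q + C = R and q ∩ C = 0, so an e
in C with e ≡ 1 mod q transports socle elements of R/q to Ann_R(Rad q), which is contained in C. -/
theorem isLocallyGorenstein_iff_hasCyclicSocles [IsArtinianRing R] :
    IsLocallyGorenstein R ↔ HasCyclicSocles R := by
  classical
  constructor
  · intro h m hm
    obtain ⟨v₀, hv₀, hmv₀⟩ := exists_ne_zero_forall_mul_eq_zero hm
    obtain ⟨t, ht⟩ := exists_isMinimalPrimaryDecomposition (⊥ : Ideal R)
    obtain ⟨q, hq, hvq⟩ := exists_mem_not_mem ht (mt (Submodule.mem_bot R).mp hv₀)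
    obtain rfl := eq_radical_of_forall_mul_mem (ht.primary hq) hm
      (fun r hr => by rw [hmv₀ r hr]; exact zero_mem _) hvq
    obtain ⟨v, hv, hmv, hgen⟩ := (isGorensteinLocal_quotient_iff hm).mp (h t ht q hq)
    obtain ⟨y, hy, e, he, hye⟩ :=
      Submodule.mem_sup.mp ((Ideal.eq_top_iff_one _).mp (sup_inf_erase_eq_top ht hq))
    have hzero : ∀ a ∈ q, a ∈ (t.erase q).inf id → a = 0 := fun a h1 h2 => by
      rw [← Submodule.mem_bot R, ← inf_inf_erase ht hq]
      exact ⟨h1, h2⟩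
    have hve : v - e * v ∈ q := by
      rw [show v - e * v = y * v by rw [← eq_sub_iff_add_eq] at hye; rw [hye]; ring]
      exact q.mul_mem_right v hy
    refine ⟨e * v, fun h0 => hv (by simpa [h0] using hve), fun r hr => ?_, fun w hw => ?_⟩
    · rw [mul_left_comm]
      exact hzero _ (q.mul_mem_left e (hmv r hr)) (Ideal.mul_mem_right _ _ he)
    · obtain ⟨c, hc⟩ := hgen w fun r hr => by rw [hw r hr]; exact zero_mem _
      refine ⟨c, sub_eq_zero.mp (hzero _ ?_ ?_)⟩
      · rw [show c * (e * v) - w = (c * v - w) - c * (v - e * v) by ring]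
        exact sub_mem hc (q.mul_mem_left c hve)
      · refine sub_mem (Ideal.mul_mem_left _ _ (Ideal.mul_mem_right _ _ he)) ?_
        exact mem_inf_erase_of_forall_mul_mem ht hq hm fun r hr => by rw [hw r hr]; exact zero_mem _
  · intro h t ht q hq
    have hm : q.radical.IsMaximal := Ideal.IsPrime.isMaximal' (Ideal.isPrime_radical (ht.primary hq))
    obtain ⟨v, hv0, hv, hgen⟩ := h _ hm
    obtain ⟨y, hy, e, he, hye⟩ :=
      Submodule.mem_sup.mp ((Ideal.eq_top_iff_one _).mp (sup_inf_erase_eq_top ht hq))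
    have hzero : ∀ a ∈ q, a ∈ (t.erase q).inf id → a = 0 := fun a h1 h2 => by
      rw [← Submodule.mem_bot R, ← inf_inf_erase ht hq]
      exact ⟨h1, h2⟩
    rw [isGorensteinLocal_quotient_iff hm]
    refine ⟨v, fun hvq => hv0 (hzero v hvq ?_), fun r hr => by rw [hv r hr]; exact zero_mem _,
      fun w hw => ?_⟩
    · exact mem_inf_erase_of_forall_mul_mem ht hq hm fun r hr => by rw [hv r hr]; exact zero_mem _
    · obtain ⟨c, hc⟩ := hgen (e * w) fun r hr => by
        rw [mul_left_comm]
        exact hzero _ (q.mul_mem_left e (hw r hr)) (Ideal.mul_mem_right _ _ he)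
      refine ⟨c, ?_⟩
      rw [hc, show e * w - w = -(y * w) by rw [← eq_sub_iff_add_eq] at hye; rw [hye]; ring]
      exact neg_mem (q.mul_mem_right w hy)

end Gorenstein

/-! ### Minimal divisors and the Cayley-Bacharach property -/

section CBP

variable {K : Type*} [Field K] {n : ℕ} {I : Ideal (MvPolynomial (Fin n) K)}
  {t : Finset (Ideal (MvPolynomial (Fin n) K))}

theorem aeval_coords_surjective : Function.Surjective
    (MvPolynomial.aeval (coords I) :
      MvPolynomial (Fin n) K →ₐ[K] MvPolynomial (Fin n) K ⧸ I) := by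
  have h : (MvPolynomial.aeval (coords I) :
      MvPolynomial (Fin n) K →ₐ[K] MvPolynomial (Fin n) K ⧸ I) = Ideal.Quotient.mkₐ K I :=
    MvPolynomial.algHom_ext fun j => by simp [coords]
  rw [h]
  exact Ideal.Quotient.mkₐ_surjective K I

/-- A simple ideal is generated by the class of some p with maximal annihilator M. As p ∉ Q, M =
Rad(Q), so p lies in the intersection C of the other components. The modular law gives (p) + I =
((p) + Q) ∩ C, and J/I ≅ P/M has the required dimension. -/
theorem isMinimalDivisor_comap_of_isAtom (ht : Submodule.IsMinimalPrimaryDecomposition I t)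
    {Q : Ideal (MvPolynomial (Fin n) K)} (hQ : Q ∈ t) {S : Ideal (MvPolynomial (Fin n) K ⧸ I)}
    (hS : IsAtom S) (hSQ : ¬ S.comap (Ideal.Quotient.mk I) ≤ Q) :
    IsMinimalDivisor I t Q (S.comap (Ideal.Quotient.mk I)) := by
  classical
  obtain ⟨a, ha0, rfl, hmax⟩ := exists_eq_span_singleton_of_isAtom hS
  obtain ⟨p, rfl⟩ := Ideal.Quotient.mk_surjective a
  have hcomap : (Ideal.span {Ideal.Quotient.mk I p}).comap (Ideal.Quotient.mk I) =
      Ideal.span {p} ⊔ I := by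
    rw [← Set.image_singleton, ← Ideal.map_span,
      Ideal.comap_map_of_surjective _ Ideal.Quotient.mk_surjective, ← RingHom.ker_eq_comap_bot,
      Ideal.mk_ker]
  have hIQ := le_of_mem_isMinimalPrimaryDecomposition ht hQ
  have hpQ : p ∉ Q := fun h => hSQ (by
    rw [hcomap]
    exact sup_le ((Ideal.span_singleton_le_iff_mem Q).mpr h) hIQ)
  set M := (Ideal.torsionOf (MvPolynomial (Fin n) K ⧸ I) (MvPolynomial (Fin n) K ⧸ I)
    (Ideal.Quotient.mk I p)).comap (Ideal.Quotient.mk I) with hM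
  have hMmax : M.IsMaximal := Ideal.comap_isMaximal_of_surjective _ Ideal.Quotient.mk_surjective
  have hMp : ∀ r, r ∈ M ↔ r * p ∈ I := by
    intro r
    rw [hM, Ideal.mem_comap, Ideal.mem_torsionOf_iff, smul_eq_mul, ← map_mul,
      Ideal.Quotient.eq_zero_iff_mem]
  have hMQ : M = Q.radical :=
    eq_radical_of_forall_mul_mem (ht.primary hQ) hMmax (fun r hr => hIQ ((hMp r).mp hr)) hpQ
  have hpC : p ∈ (t.erase Q).inf id :=
    mem_inf_erase_of_forall_mul_mem ht hQ (hMQ ▸ hMmax) fun r hr =>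
      (hMp r).mp (hMQ ▸ hr)
  have hIC : I ≤ (t.erase Q).inf id := by
    rw [← inf_inf_erase ht hQ]
    exact inf_le_right
  refine ⟨⟨Ideal.span {p} ⊔ Q, ?_, ?_⟩, ?_⟩
  · refine lt_of_le_of_ne le_sup_right fun h => hpQ ?_
    rw [h]
    exact Ideal.mem_sup_left (Ideal.mem_span_singleton_self p)
  · have h : ((t.erase Q).inf id : Ideal (MvPolynomial (Fin n) K)) ⊓ Q = I := by
      rw [inf_comm, inf_inf_erase ht hQ]
    convert (hcomap.trans (congrArg (Ideal.span {p} ⊔ ·) (inf_inf_erase ht hQ).symm)).trans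
      (sup_inf_assoc_of_le Q ((Ideal.span_singleton_le_iff_mem _).mpr hpC)).symm
  · rw [Ideal.map_comap_of_surjective _ Ideal.Quotient.mk_surjective, ← hMQ]
    let g : MvPolynomial (Fin n) K →ₗ[K] MvPolynomial (Fin n) K ⧸ I :=
      LinearMap.mulRight K (Ideal.Quotient.mk I p) ∘ₗ (Ideal.Quotient.mkₐ K I).toLinearMap
    have hker : LinearMap.ker g = M.restrictScalars K := by
      ext r
      rw [Submodule.restrictScalars_mem, hMp, ← Ideal.Quotient.eq_zero_iff_mem, map_mul]
      rfl
    have hrange : LinearMap.range g =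
        (Ideal.span {Ideal.Quotient.mk I p}).restrictScalars K := by
      ext r
      rw [Submodule.restrictScalars_mem, Ideal.mem_span_singleton']
      constructor
      · rintro ⟨s, rfl⟩
        exact ⟨Ideal.Quotient.mk I s, rfl⟩
      · rintro ⟨s, rfl⟩
        obtain ⟨s, rfl⟩ := Ideal.Quotient.mk_surjective s
        exact ⟨s, rfl⟩
    have h1 := g.quotKerEquivRange.finrank_eq
    rw [hker, hrange] at h1
    exact h1.symm.trans (Submodule.Quotient.restrictScalarsEquiv K M).finrank_eq

variable [Module.Finite K (MvPolynomial (Fin n) K ⧸ I)]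

theorem IsMinimalDivisor.map_ne_bot (ht : Submodule.IsMinimalPrimaryDecomposition I t)
    {Q : Ideal (MvPolynomial (Fin n) K)} (hQ : Q ∈ t) {J : Ideal (MvPolynomial (Fin n) K)}
    (hJ : IsMinimalDivisor I t Q J) : J.map (Ideal.Quotient.mk I) ≠ ⊥ := by
  intro h0
  have hle : I ≤ Q.radical :=
    (le_of_mem_isMinimalPrimaryDecomposition ht hQ).trans Ideal.le_radical
  have : Module.Finite K (MvPolynomial (Fin n) K ⧸ Q.radical) :=
    Module.Finite.of_surjective (Ideal.Quotient.factorₐ K hle).toLinearMap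
      (Ideal.Quotient.factor_surjective hle)
  have : Nontrivial (MvPolynomial (Fin n) K ⧸ Q.radical) :=
    Ideal.Quotient.nontrivial_iff.mpr (Ideal.isPrime_radical (ht.primary hQ)).ne_top
  have hpos : 0 < Module.finrank K (MvPolynomial (Fin n) K ⧸ Q.radical) := Module.finrank_pos
  rw [← hJ.2, h0] at hpos
  exact hpos.ne' (finrank_bot K (MvPolynomial (Fin n) K ⧸ I))

/-- A non-zero ideal inside F_{r-1}R would contain a simple ideal, whose preimage is a minimal
divisor of too small degree. Conversely, if there is no such ideal, every minimal divisor attains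
the regularity index. -/
theorem hasCayleyBacharachProperty_iff [Nontrivial (MvPolynomial (Fin n) K ⧸ I)] :
     HasCayleyBacharachProperty I ↔
    ∀ a, (∀ g, a * g ∈ degreeFiltration K (coords I) (regularityIndex K (coords I) - 1)) →
      a = 0 := by
  classical
  have hx := aeval_coords_surjective (I := I)
  have : IsArtinianRing (MvPolynomial (Fin n) K ⧸ I) := isArtinian_of_tower K inferInstance
  constructor
  · intro h a ha
    by_contra hne
    obtain ⟨S, hS, hSa⟩ := (eq_bot_or_exists_atom_le (Ideal.span {a})).resolve_left
      fun h => hne (Ideal.span_singleton_eq_bot.mp h)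
    obtain ⟨s, hsS, hs0⟩ := Submodule.exists_mem_ne_zero_of_ne_bot hS.1
    obtain ⟨p, rfl⟩ := Ideal.Quotient.mk_surjective s
    obtain ⟨t, ht⟩ := exists_isMinimalPrimaryDecomposition I
    obtain ⟨Q, hQ, hpQ⟩ := exists_mem_not_mem ht (mt Ideal.Quotient.eq_zero_iff_mem.mpr hs0)
    have hJ := isMinimalDivisor_comap_of_isAtom ht hQ hS fun hle => hpQ (hle hsS)
    have hmap := Ideal.map_comap_of_surjective _ (Ideal.Quotient.mk_surjective (I := I)) S
    have hle : separatorDegree I t Q ≤ idealRegularityIndex K (coords I) S := by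
      refine csInf_le ⟨0, ?_⟩ ⟨_, hJ, by rw [hmap]⟩
      rintro _ ⟨J, hJ, rfl⟩
      exact idealRegularityIndex_nonneg _ hx (hJ.map_ne_bot ht hQ)
    rw [h t ht Q hQ] at hle
    obtain ⟨b, hbS, hb⟩ := (idealRegularityIndex_eq_iff _ hx hS.1).mp
      (le_antisymm (idealRegularityIndex_le_regularityIndex _ hx hS.1) hle)
    obtain ⟨r, rfl⟩ := Ideal.mem_span_singleton'.mp (hSa hbS)
    rw [mul_comm] at hb
    exact hb (ha r)
  · intro h t ht Q hQ
    have hreg : ∀ J, IsMinimalDivisor I t Q J → idealRegularityIndex K (coords I)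
        (J.map (Ideal.Quotient.mk I)) = regularityIndex K (coords I) := by
      intro J hJ
      have hne := hJ.map_ne_bot ht hQ
      rw [idealRegularityIndex_eq_iff _ hx hne]
      by_contra! hle
      obtain ⟨b, hb, hb0⟩ := Submodule.exists_mem_ne_zero_of_ne_bot hne
      exact hb0 (h b fun g => hle _ (Ideal.mul_mem_right g _ hb))
    -- Existence matters because `sInf ∅ = 0`. By minimality of the decomposition C is not contained
    -- in Q, so C/I contains a simple ideal; this one is not inside Q/I, since Q ∩ C = I.
    obtain ⟨J, hJ⟩ : ∃ J, IsMinimalDivisor I t Q J := by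
      have hC := ht.minimal hQ
      have hIC : I ≤ (t.erase Q).inf id := by
        rw [← inf_inf_erase ht hQ]
        exact inf_le_right
      obtain ⟨S, hS, hSC⟩ := (eq_bot_or_exists_atom_le
        (((t.erase Q).inf id : Ideal (MvPolynomial (Fin n) K)).map
          (Ideal.Quotient.mk I))).resolve_left fun h0 => by
            rw [Ideal.map_eq_bot_iff_le_ker, Ideal.mk_ker] at h0
            refine hC ?_
            convert h0.trans (le_of_mem_isMinimalPrimaryDecomposition ht hQ)
      refine ⟨_, isMinimalDivisor_comap_of_isAtom ht hQ hS fun hle => ?_⟩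
      obtain ⟨s, hsS, hs0⟩ := Submodule.exists_mem_ne_zero_of_ne_bot hS.1
      obtain ⟨p, rfl⟩ := Ideal.Quotient.mk_surjective s
      refine hs0 (Ideal.Quotient.eq_zero_iff_mem.mpr ?_)
      rw [← inf_inf_erase ht hQ]
      refine ⟨hle hsS, ?_⟩
      have h1 := hSC hsS
      rw [← Ideal.mem_comap, Ideal.comap_map_of_surjective _ Ideal.Quotient.mk_surjective,
        ← RingHom.ker_eq_comap_bot, Ideal.mk_ker, sup_eq_left.mpr hIC] at h1
      exact h1
    have hset : {r : ℤ | ∃ J, IsMinimalDivisor I t Q J ∧ idealRegularityIndex K (coords I)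
        (J.map (Ideal.Quotient.mk I)) = r} = {regularityIndex K (coords I)} := by
      ext r
      constructor
      · rintro ⟨J, hJ, rfl⟩
        exact hreg J hJ
      · rintro rfl
        exact ⟨J, hJ, hreg J hJ⟩
    rw [separatorDegree, hset, csInf_singleton]

end CBP

end CayleyBacharach

end

theorem theorem5p5 {K : Type u} [Field K] {n : ℕ} (I : Ideal (MvPolynomial (Fin n) K))
    (hI : ringKrullDim (MvPolynomial (Fin n) K ⧸ I) = 0) :
    ((∃ (L : Type (max u v)) (_ : Field L) (_ : Algebra K L),
        CayleyBacharach.HasFaithfulFormOfLeastOrder L (CayleyBacharach.coordsBaseChange I L)) ↔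
      (CayleyBacharach.IsLocallyGorenstein (MvPolynomial (Fin n) K ⧸ I) ∧
        CayleyBacharach.HasCayleyBacharachProperty I)) ∧
    (Infinite K →
      CayleyBacharach.IsLocallyGorenstein (MvPolynomial (Fin n) K ⧸ I) →
        CayleyBacharach.HasCayleyBacharachProperty I →
          CayleyBacharach.HasFaithfulFormOfLeastOrder K (CayleyBacharach.coordsBaseChange I K)) := by
  have : Nontrivial (MvPolynomial (Fin n) K ⧸ I) := by
    rw [← not_subsingleton_iff_nontrivial]
    intro h
    rw [ringKrullDim_eq_bot_of_subsingleton] at hI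
    exact WithBot.bot_ne_zero hI
  have : Module.Finite K (MvPolynomial (Fin n) K ⧸ I) :=
    (Module.finite_iff_krullDimLE_zero K _).mpr (ringKrullDimZero_iff_ringKrullDim_eq_zero.mpr hI)
  have : IsArtinianRing (MvPolynomial (Fin n) K ⧸ I) := isArtinian_of_tower K inferInstance
  have hx := CayleyBacharach.aeval_coords_surjective (I := I)
  rw [CayleyBacharach.isLocallyGorenstein_iff_hasCyclicSocles,
    CayleyBacharach.hasCayleyBacharachProperty_iff]
  refine ⟨⟨?_, ?_⟩, fun _ h h' => .of_hasCyclicSocles K hx h h'⟩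
  · rintro ⟨L, _, _, h⟩
    exact ⟨h.hasCyclicSocles L hx, fun a ha => h.eq_zero_of_forall_mul_mem L hx ha⟩
  · rintro ⟨h, h'⟩
    -- K(X) is an infinite extension of any K; `ULift` only moves it to the required universe.
    have : Infinite (RatFunc K) :=
      .of_injective (algebraMap (Polynomial K) (RatFunc K)) (RatFunc.algebraMap_injective K)
    have : Infinite (ULift.{v} (RatFunc K)) := .of_injective ULift.up ULift.up_injective
    exact ⟨ULift.{v} (RatFunc K), inferInstance, inferInstance, .of_hasCyclicSocles _ hx h h'⟩
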